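/- A generalized semi-Markov process (GSMP) consists of: a finite set $S$ of states; for each $s\in S$ a finite set $I(s)$ of events (clocks) with rates $r_{s,i}>0$, $i\in I(s)$, and a set $\mathrm{Props}(s)$ of atomic propositions; for $i\in I(s)$ probabilities $\mathrm{next}_i(s,s')\ge 0$ with $\sum_{s'}\mathrm{next}_i(s,s')=1$; and for $i\in I(s)$, $s'\in S$, $i'\in I(s')$ a probability density $f(\cdot\,;s,i;s',i')$ on $(0,\infty)$, continuous there. At $\langle s,c\rangle$ with $c\in[0,\infty)^{I(s)}$ such that exactly one clock $i$ reaches zero first, at time $T(\langle s,c\rangle)=\min_j c_j/r_{s,j}$, the next state is $s'$ with probability $\mathrm{next}_i(s,s')$; the clocks in $(I(s)\setminus\{i\})\cap I(s')$ keep the values they have at time $T(\langle s,c\rangle)$, and the other clocks $i'\in I(s')$ get independent new values with densities $f(\cdot\,;s,i;s',i')$. Let $\mathcal G$ be the set of generalized states: those $\langle s,c\rangle$ with $c\ge 0$ for which a unique clock reaches zero first and for which, almost surely, this remains true after every transition. A sequence $(g_n)$ in $\mathcal G$ is finitely varying if $\sum_n T(g_n)=\infty$. It generates the function $[0,\infty)\to\mathcal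 G$ whose value at $t$, for $\sum_{j<n}T(g_j)\le t<\sum_{j\le n}T(g_j)$, is $g_n$ with its clocks run down for the time $t-\sum_{j<n}T(g_j)$. Let $\mathrm{Traces}(g)$ be the law, on finitely varying sequences, of the Markov process just described that starts at $g$. Pseudometrics take values in $[0,1]$ and are ordered by $m_1\preceq m_2$ iff $m_1\ge m_2$ pointwise. Let $\mathcal M$ be the class of pseudometrics $m$ on $\mathcal G$ with $m(\langle s,c\rangle,\langle s',c'\rangle)=1$ whenever $\mathrm{Props}(s)\ne\mathrm{Props}(s')$. For functions $f,g:[0,\infty)\to\mathcal G$ let $$J(m)(f,g)=\max\Big(\sup_t\inf_{t'}\max\big(m(f(t),g(t')),|t-t'|\big),\ \sup_{t'}\inf_{t}\max\big(m(f(t),g(t')),|t-t'|\big)\Big),$$ and let $J(m)$ also denote the induced pseudometric on finitely varying sequences. For a pseudometric $d$ and probability measures $P,Q$ let $W(d)(P,Q)=\sup_h\big|\int h\,dP-\int h\,dQ\big|$, over all functions $h$ into $[0,1]$ with $|h(x)-h(y)|\le d(x,y)$ for all $x,y$ (for non-measurable $h$ the integrals are upper integrals). For $0<k<1$ and a pseudometric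 $m$ on $\mathcal G$ let $\mathcal F_k(m)(\langle s,c\rangle,\langle s',c'\rangle)$ be $1$ if $\mathrm{Props}(s)\neq\mathrm{Props}(s')$ and $k\cdot W(J(m))(\mathrm{Traces}\langle s,c\rangle,\mathrm{Traces}\langle s',c'\rangle)$ otherwise. **Lemma ($\mathcal F_k$ has closure ordinal $\omega$).** For every GSMP and every $0<k<1$, $\mathcal F_k$ has a greatest fixed point $m_{\mathcal F_k}$ in $(\mathcal M,\preceq)$. Let $m_0=\top$ be the zero pseudometric, or alternatively the largest element of $\mathcal M$ (distance $0$ between generalized states with the same propositions, $1$ otherwise), and let $m_{i+1}=\mathcal F_k(m_i)$. Then $m_0\succeq m_1\succeq m_2\succeq\cdots$, and $m_{\mathcal F_k}$ is the limit of this $\omega$-chain: it is the greatest lower bound of the $m_i$ with respect to $\preceq$, and $m_i(g,g')\to m_{\mathcal F_k}(g,g')$ for all $g,g'\in\mathcal G$. -/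

import Mathlib

open MeasureTheory ProbabilityTheory Filter Topology Set
open scoped ENNReal NNReal

/-! ### Pseudometrics bounded by one, and their lattice order -/

/-- A pseudometric with values in `[0,1]`. -/
structure UnitPseudometric (X : Type*) where
  toFun : X → X → ℝ
  nonneg : ∀ x y, 0 ≤ toFun x y
  le_one : ∀ x y, toFun x y ≤ 1
  self : ∀ x, toFun x x = 0
  symm : ∀ x y, toFun x y = toFun y x
  triangle : ∀ x y z, toFun x z ≤ toFun x y + toFun y z

namespace UnitPseudometric

variable {X : Type*}

instance : CoeFun (UnitPseudometric X) (fun _ => X → X → ℝ) := ⟨toFun⟩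

@[ext]
theorem ext {m m' : UnitPseudometric X} (h : ∀ x y, m x y = m' x y) : m = m' := by
  cases m; cases m'
  congr
  funext x y
  exact h x y

/-- The order is reversed: `m₁ ≤ m₂` means that `m₁` assigns the larger distances. -/
instance : PartialOrder (UnitPseudometric X) where
  le m₁ m₂ := ∀ x y, m₂ x y ≤ m₁ x y
  le_refl _ _ _ := le_rfl
  le_trans _ _ _ h h' x y := (h' x y).trans (h x y)
  le_antisymm _ _ h h' := ext fun x y => le_antisymm (h' x y) (h x y)

theorem le_def {m₁ m₂ : UnitPseudometric X} : m₁ ≤ m₂ ↔ ∀ x y, m₂ x y ≤ m₁ x y := Iff.rfl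

/-- The zero pseudometric, the largest element of the order. -/
instance : OrderTop (UnitPseudometric X) where
  top := ⟨fun _ _ => 0, by simp, by simp, by simp, by simp, by simp⟩
  le_top m x y := m.nonneg x y

theorem top_apply (x y : X) : (⊤ : UnitPseudometric X) x y = 0 := rfl

end UnitPseudometric

/-! ### The Skorohod J2 distance -/

section Skorohod

variable {X : Type*}

/-- `sup_t inf_{t'} max (m (f t) (g t')) |t - t'|`: the one-sided Hausdorff distance from the graph
of `f` to the graph of `g`. -/
noncomputable def graphExcess (m : UnitPseudometric X) (f g : ℝ≥0 → X) : ℝ :=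
  ⨆ t : ℝ≥0, ⨅ t' : ℝ≥0, max (m (f t) (g t')) |(t : ℝ) - t'|

theorem graphExcess_bddBelow (m : UnitPseudometric X) (f g : ℝ≥0 → X) (t : ℝ≥0) :
    BddBelow (range fun t' : ℝ≥0 => max (m (f t) (g t')) |(t : ℝ) - t'|) :=
  ⟨0, by rintro _ ⟨t', rfl⟩; exact (abs_nonneg _).trans (le_max_right _ _)⟩

theorem graphExcess_inner_le_one (m : UnitPseudometric X) (f g : ℝ≥0 → X) (t : ℝ≥0) :
    ⨅ t' : ℝ≥0, max (m (f t) (g t')) |(t : ℝ) - t'| ≤ 1 :=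
  (ciInf_le (graphExcess_bddBelow m f g t) t).trans (by simpa using m.le_one _ _)

theorem graphExcess_bddAbove (m : UnitPseudometric X) (f g : ℝ≥0 → X) :
    BddAbove (range fun t : ℝ≥0 => ⨅ t' : ℝ≥0, max (m (f t) (g t')) |(t : ℝ) - t'|) :=
  ⟨1, by rintro _ ⟨t, rfl⟩; exact graphExcess_inner_le_one m f g t⟩

theorem graphExcess_nonneg (m : UnitPseudometric X) (f g : ℝ≥0 → X) : 0 ≤ graphExcess m f g :=
  Real.iSup_nonneg fun _ => Real.iInf_nonneg fun _ => (abs_nonneg _).trans (le_max_right _ _)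

theorem graphExcess_le_one (m : UnitPseudometric X) (f g : ℝ≥0 → X) : graphExcess m f g ≤ 1 :=
  ciSup_le fun t => graphExcess_inner_le_one m f g t

theorem graphExcess_self (m : UnitPseudometric X) (f : ℝ≥0 → X) : graphExcess m f f = 0 := by
  refine le_antisymm (ciSup_le fun t => ?_) (graphExcess_nonneg m f f)
  exact (ciInf_le (graphExcess_bddBelow m f f t) t).trans (by simp [m.self])

theorem graphExcess_triangle (m : UnitPseudometric X) (f g h : ℝ≥0 → X) :
    graphExcess m f h ≤ graphExcess m f g + graphExcess m g h := by
  refine ciSup_le fun t => ?_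
  refine le_of_forall_pos_le_add fun ε hε => ?_
  have h1 : ⨅ t' : ℝ≥0, max (m (f t) (g t')) |(t : ℝ) - t'| < graphExcess m f g + ε / 2 :=
    lt_of_le_of_lt (le_ciSup (graphExcess_bddAbove m f g) t)
      (lt_add_of_pos_right (graphExcess m f g) (half_pos hε))
  obtain ⟨u, hu⟩ := exists_lt_of_ciInf_lt h1
  have h2 : ⨅ t' : ℝ≥0, max (m (g u) (h t')) |(u : ℝ) - t'| < graphExcess m g h + ε / 2 :=
    lt_of_le_of_lt (le_ciSup (graphExcess_bddAbove m g h) u)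
      (lt_add_of_pos_right (graphExcess m g h) (half_pos hε))
  obtain ⟨v, hv⟩ := exists_lt_of_ciInf_lt h2
  refine (ciInf_le (graphExcess_bddBelow m f h t) v).trans ?_
  have a1 := m.triangle (f t) (g u) (h v)
  have a2 := abs_sub_le (t : ℝ) u v
  have b1 := max_lt_iff.1 hu
  have b2 := max_lt_iff.1 hv
  exact max_le (by linarith [b1.1, b2.1]) (by linarith [b1.2, b2.2])

/-- The Skorohod J2 distance of two functions `[0,∞) → X`: the Hausdorff distance of their graphs
in `[0,∞) × X` with the maximum metric. -/
noncomputable def skorohodJ2 (m : UnitPseudometric X) : UnitPseudometric (ℝ≥0 → X) where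
  toFun f g := max (graphExcess m f g)
    (⨆ t' : ℝ≥0, ⨅ t : ℝ≥0, max (m (f t) (g t')) |(t : ℝ) - t'|)
  nonneg f g := (graphExcess_nonneg m f g).trans (le_max_left _ _)
  le_one f g := by
    refine max_le (graphExcess_le_one m f g) ?_
    simpa only [graphExcess, m.symm, abs_sub_comm] using graphExcess_le_one m g f
  self f := by
    have := graphExcess_self m f
    refine (max_eq_left ?_).trans this
    rw [this]
    refine le_of_eq (Eq.trans ?_ this)
    simp only [graphExcess]
    congr 1; funext t; congr 1; funext t'
    rw [m.symm, abs_sub_comm]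
  symm f g := by
    rw [max_comm]
    congr 1 <;>
    · simp only [graphExcess]
      congr 1; funext t; congr 1; funext t'
      rw [m.symm, abs_sub_comm]
  triangle f g h := by
    have key : ∀ a b : ℝ≥0 → X,
        (⨆ t' : ℝ≥0, ⨅ t : ℝ≥0, max (m (a t) (b t')) |(t : ℝ) - t'|) = graphExcess m b a := by
      intro a b
      simp only [graphExcess]
      congr 1; funext t; congr 1; funext t'
      rw [m.symm, abs_sub_comm]
    simp only [key]
    have h1 := graphExcess_triangle m f g h
    have h2 := graphExcess_triangle m h g f
    refine max_le (h1.trans (add_le_add (le_max_left _ _) (le_max_left _ _))) ?_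
    rw [add_comm]
    rw [add_comm] at h2
    exact (h2.trans (add_le_add (le_max_right _ _) (le_max_right _ _))).trans (add_comm _ _).le

end Skorohod

/-! ### The Wasserstein distance -/

section Wasserstein

/-- The functions `h : Ω → [0,1]` with `|h x - h y| ≤ d x y`. -/
def IsTest {Ω : Type*} (d : UnitPseudometric Ω) (h : Ω → ℝ) : Prop :=
  (∀ x, 0 ≤ h x ∧ h x ≤ 1) ∧ ∀ x y, |h x - h y| ≤ d x y

theorem isTest_zero {Ω : Type*} {d : UnitPseudometric Ω} : IsTest d (fun _ => 0) :=
  ⟨by simp, fun x y => by simpa using d.nonneg x y⟩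

variable {Ω : Type*} [MeasurableSpace Ω]

/-- The upper integral of a function `h ≥ 0`; it is the integral of `h` if `h` is measurable. -/
noncomputable def upperIntegral (P : Measure Ω) (h : Ω → ℝ) : ℝ :=
  (⨅ (φ : Ω → ℝ≥0∞) (_ : Measurable φ) (_ : ∀ ω, ENNReal.ofReal (h ω) ≤ φ ω),
    ∫⁻ ω, φ ω ∂P).toReal

theorem upperIntegral_eq_integral (P : Measure Ω) {h : Ω → ℝ} (hm : Measurable h)
    (h0 : ∀ ω, 0 ≤ h ω) : upperIntegral P h = ∫ ω, h ω ∂P := by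
  rw [integral_eq_lintegral_of_nonneg_ae (ae_of_all _ h0) hm.aestronglyMeasurable, upperIntegral]
  congr 1
  refine le_antisymm ?_ ?_
  · exact iInf_le_of_le _ (iInf_le_of_le hm.ennreal_ofReal (iInf_le_of_le (fun _ => le_rfl) le_rfl))
  · exact le_iInf fun φ => le_iInf fun _ => le_iInf fun hφ => lintegral_mono hφ

/-- The Wasserstein distance: the supremum of `∫ h dP - ∫ h dQ` over all functions `h` into
`[0,1]` that are Lipschitz for `d`. The pseudometric `d` is arbitrary, so `h` need not be measurable,
and the integrals are upper integrals. The absolute value is redundant for measurable `h`, because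
`1 - h` is Lipschitz if `h` is. -/
noncomputable def wasserstein (d : UnitPseudometric Ω) (P Q : Measure Ω) : ℝ :=
  sSup {r | ∃ h : Ω → ℝ, IsTest d h ∧ r = |upperIntegral P h - upperIntegral Q h|}

variable {d : UnitPseudometric Ω} {P Q R : Measure Ω}

theorem upperIntegral_mem {h : Ω → ℝ} (hP : P univ ≤ 1) (hh : IsTest d h) :
    0 ≤ upperIntegral P h ∧ upperIntegral P h ≤ 1 := by
  refine ⟨ENNReal.toReal_nonneg, ?_⟩
  refine ENNReal.toReal_le_of_le_ofReal zero_le_one ?_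
  rw [ENNReal.ofReal_one]
  refine le_trans (iInf_le_of_le (fun _ => 1) (iInf_le_of_le measurable_const
    (iInf_le_of_le (fun ω => ?_) le_rfl))) ?_
  · exact ENNReal.ofReal_le_one.2 (hh.1 ω).2
  · simpa using hP

theorem wasserstein_bddAbove (hP : P univ ≤ 1) (hQ : Q univ ≤ 1) :
    BddAbove {r | ∃ h : Ω → ℝ, IsTest d h ∧ r = |upperIntegral P h - upperIntegral Q h|} := by
  refine ⟨1, ?_⟩
  rintro _ ⟨h, hh, rfl⟩
  have h1 := upperIntegral_mem hP hh
  have h2 := upperIntegral_mem hQ hh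
  exact abs_le.2 ⟨by linarith, by linarith⟩

theorem wasserstein_nonneg : 0 ≤ wasserstein d P Q := by
  refine Real.sSup_nonneg ?_
  rintro _ ⟨h, -, rfl⟩
  exact abs_nonneg _

theorem wasserstein_le_one (hP : P univ ≤ 1) (hQ : Q univ ≤ 1) : wasserstein d P Q ≤ 1 := by
  refine csSup_le ⟨_, _, isTest_zero, rfl⟩ ?_
  rintro _ ⟨h, hh, rfl⟩
  have h1 := upperIntegral_mem hP hh
  have h2 := upperIntegral_mem hQ hh
  exact abs_le.2 ⟨by linarith, by linarith⟩

theorem wasserstein_self : wasserstein d P P = 0 := by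
  refine le_antisymm (csSup_le ⟨_, _, isTest_zero, rfl⟩ ?_) wasserstein_nonneg
  rintro _ ⟨h, -, rfl⟩
  simp

theorem wasserstein_comm : wasserstein d P Q = wasserstein d Q P := by
  simp only [wasserstein, abs_sub_comm]

theorem wasserstein_triangle (hP : P univ ≤ 1) (hQ : Q univ ≤ 1) (hR : R univ ≤ 1) :
    wasserstein d P R ≤ wasserstein d P Q + wasserstein d Q R := by
  refine csSup_le ⟨_, _, isTest_zero, rfl⟩ ?_
  rintro _ ⟨h, hh, rfl⟩
  exact (abs_sub_le _ _ _).trans (add_le_add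
    (le_csSup (wasserstein_bddAbove hP hQ) ⟨h, hh, rfl⟩)
    (le_csSup (wasserstein_bddAbove hQ hR) ⟨h, hh, rfl⟩))

end Wasserstein

/-! ### Generalized semi-Markov processes -/

/-- A generalized semi-Markov process with finite state set `S`, events from `E` and atomic
propositions from `AP`. The density `density s i s' i'` is used to set the clock `i'` when the
event `i` takes the process from `s` to `s'`. -/
structure GSMP (AP S E : Type*) [Fintype S] where
  events : S → Finset E
  rate : (s : S) → events s → ℝ
  rate_pos : ∀ s i, 0 < rate s i
  props : S → Set AP
  density : (s : S) → events s → (s' : S) → events s' → ℝ → ℝ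
  density_nonneg : ∀ s i s' i' t, 0 < t → 0 ≤ density s i s' i' t
  density_continuousOn : ∀ s i s' i', ContinuousOn (density s i s' i') (Ioi 0)
  lintegral_density : ∀ s i s' i', ∫⁻ t in Ioi (0 : ℝ), ENNReal.ofReal (density s i s' i' t) = 1
  next : (s : S) → events s → S → ℝ
  next_nonneg : ∀ s i s', 0 ≤ next s i s'
  next_sum : ∀ s i, ∑ s', next s i s' = 1

namespace GSMP

variable {AP S E : Type*} [Fintype S]

/-- A state together with a vector of real numbers indexed by its events. -/
abbrev ClockState (M : GSMP AP S E) : Type _ := Σ s : S, (M.events s → ℝ)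

variable (M : GSMP AP S E)

/-- The clock `i` reaches zero strictly before all other clocks. -/
def IsFirst (s : S) (c : M.events s → ℝ) (i : M.events s) : Prop :=
  ∀ j, j ≠ i → c i / M.rate s i < c j / M.rate s j

/-- The clock values are nonnegative and exactly one clock reaches zero first. -/
def valid : Set M.ClockState :=
  {x | (∀ i, 0 ≤ x.2 i) ∧ ∃ i, M.IsFirst x.1 x.2 i}

/-- The time until the first clock reaches zero. -/
noncomputable def firingTime (x : M.ClockState) : ℝ :=
  ⨅ i : M.events x.1, x.2 i / M.rate x.1 i

/-- The clock vector after time `u` without a transition. -/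
def evolve (x : M.ClockState) (u : ℝ) : M.ClockState :=
  ⟨x.1, fun i => x.2 i - M.rate x.1 i * u⟩

/-- The law of a newly set clock. -/
noncomputable def clockLaw (s : S) (i : M.events s) (s' : S) (i' : M.events s') : Measure ℝ :=
  (volume.restrict (Ioi 0)).withDensity fun t => ENNReal.ofReal (M.density s i s' i' t)

/-- Independent new values for all clocks of `s'`. -/
noncomputable def freshLaw (s : S) (i : M.events s) (s' : S) : Measure (M.events s' → ℝ) :=
  Measure.pi (M.clockLaw s i s')

open Classical in
/-- The clock vector in `s'` after the event `i` fires: the clocks of `s` other than `i` that are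
still present in `s'` keep the values they have at the firing time, all others take the new
values `y`. -/
noncomputable def reset (s : S) (c : M.events s → ℝ) (i : M.events s) (s' : S)
    (y : M.events s' → ℝ) : M.events s' → ℝ :=
  fun j => if h : j.1 ∈ M.events s ∧ j.1 ≠ i.1 then
    c ⟨j.1, h.1⟩ - M.rate s ⟨j.1, h.1⟩ * M.firingTime ⟨s, c⟩ else y j

open Classical in
/-- The law of the next state and clock vector; at a valid clock state exactly one of the events
`i` contributes to the sum. A clock state that is not valid is never left. -/
noncomputable def stepLaw (s : S) (c : M.events s → ℝ) : Measure M.ClockState :=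
  if (⟨s, c⟩ : M.ClockState) ∈ M.valid then
    ∑ i : M.events s, if M.IsFirst s c i then
      ∑ s' : S, ENNReal.ofReal (M.next s i s') •
        (M.freshLaw s i s').map fun y => (⟨s', M.reset s c i s' y⟩ : M.ClockState)
    else 0
  else Measure.dirac ⟨s, c⟩

instance (s : S) (i : M.events s) (s' : S) (i' : M.events s') :
    IsProbabilityMeasure (M.clockLaw s i s' i') :=
  ⟨by rw [clockLaw, withDensity_apply _ MeasurableSet.univ, Measure.restrict_univ,
    M.lintegral_density]⟩

instance (s : S) (i : M.events s) (s' : S) : IsProbabilityMeasure (M.freshLaw s i s') := by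
  unfold freshLaw; infer_instance

theorem measurable_sigmaMk (s : S) :
    Measurable (fun c : M.events s → ℝ => (⟨s, c⟩ : M.ClockState)) :=
  fun _ ht => (MeasurableSpace.measurableSet_iInf.1 ht) s

theorem measurable_of_fibers {Y : Type*} [MeasurableSpace Y] {f : M.ClockState → Y}
    (h : ∀ s, Measurable fun c : M.events s → ℝ => f ⟨s, c⟩) : Measurable f :=
  fun _ ht => MeasurableSpace.measurableSet_iInf.2 fun s => h s ht

theorem measurable_firingTime : Measurable M.firingTime := by
  refine M.measurable_of_fibers fun s => ?_
  exact Measurable.iInf (f := fun (i : M.events s) (c : M.events s → ℝ) => c i / M.rate s i)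
    fun i => (measurable_pi_apply i).div_const _

theorem measurableSet_isFirst (s : S) (i : M.events s) :
    MeasurableSet {c : M.events s → ℝ | M.IsFirst s c i} := by
  have : {c : M.events s → ℝ | M.IsFirst s c i} =
      ⋂ j, ⋂ (_ : j ≠ i), {c | c i / M.rate s i < c j / M.rate s j} := by
    ext c; simp [IsFirst]
  rw [this]
  exact MeasurableSet.iInter fun j => MeasurableSet.iInter fun _ =>
    measurableSet_lt ((measurable_pi_apply i).div_const _) ((measurable_pi_apply j).div_const _)

theorem measurableSet_valid_fiber (s : S) :
    MeasurableSet {c : M.events s → ℝ | (⟨s, c⟩ : M.ClockState) ∈ M.valid} := by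
  have : {c : M.events s → ℝ | (⟨s, c⟩ : M.ClockState) ∈ M.valid} =
      (⋂ i, {c | 0 ≤ c i}) ∩ ⋃ i, {c | M.IsFirst s c i} := by
    ext c; simp [valid]
  rw [this]
  exact (MeasurableSet.iInter fun i => measurableSet_le measurable_const
    (measurable_pi_apply i)).inter (MeasurableSet.iUnion fun i => M.measurableSet_isFirst s i)

theorem measurableSet_valid : MeasurableSet M.valid :=
  MeasurableSpace.measurableSet_iInf.2 fun s => M.measurableSet_valid_fiber s

theorem measurable_reset (s : S) (i : M.events s) (s' : S) :
    Measurable fun p : (M.events s → ℝ) × (M.events s' → ℝ) => M.reset s p.1 i s' p.2 := by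
  refine measurable_pi_lambda _ fun j => ?_
  unfold reset
  by_cases h : j.1 ∈ M.events s ∧ j.1 ≠ i.1
  · simp only [dif_pos h]
    exact ((measurable_pi_apply _).comp measurable_fst).sub
      (((M.measurable_firingTime.comp (M.measurable_sigmaMk s)).comp measurable_fst).const_mul _)
  · simp only [dif_neg h]
    exact (measurable_pi_apply _).comp measurable_snd

theorem measurable_stepLaw_fiber (s : S) : Measurable (M.stepLaw s) := by
  classical
  refine Measure.measurable_of_measurable_coe _ fun A hA => ?_
  have key : (fun c => M.stepLaw s c A) = fun c =>
      if (⟨s, c⟩ : M.ClockState) ∈ M.valid then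
        ∑ i : M.events s, if M.IsFirst s c i then
          ∑ s' : S, ENNReal.ofReal (M.next s i s') *
            (M.freshLaw s i s')
              (Prod.mk c ⁻¹' {p | (⟨s', M.reset s p.1 i s' p.2⟩ : M.ClockState) ∈ A})
        else 0
      else A.indicator 1 (⟨s, c⟩ : M.ClockState) := by
    funext c
    unfold stepLaw
    split_ifs with h
    · rw [Measure.finsetSum_apply]
      refine Finset.sum_congr rfl fun i _ => ?_
      split_ifs with hi
      · rw [Measure.finsetSum_apply]
        refine Finset.sum_congr rfl fun s' _ => ?_
        rw [Measure.smul_apply, smul_eq_mul, Measure.map_apply _ hA]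
        · rfl
        · exact (M.measurable_sigmaMk s').comp
            ((M.measurable_reset s i s').comp measurable_prodMk_left)
      · rfl
    · rw [Measure.dirac_apply' _ hA]
  rw [key]
  refine Measurable.ite (M.measurableSet_valid_fiber s) ?_ ?_
  · refine Finset.measurable_sum _ fun i _ => ?_
    refine Measurable.ite (M.measurableSet_isFirst s i) ?_ measurable_const
    refine Finset.measurable_sum _ fun s' _ => Measurable.const_mul ?_ _
    exact measurable_measure_prodMk_left
      (((M.measurable_sigmaMk s').comp (M.measurable_reset s i s')) hA)
  · exact (measurable_one.indicator hA).comp (M.measurable_sigmaMk s)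

/-- The transition kernel of the discrete-time Markov process of states and clock vectors. -/
noncomputable def step : Kernel M.ClockState M.ClockState where
  toFun x := M.stepLaw x.1 x.2
  measurable' := M.measurable_of_fibers fun s => M.measurable_stepLaw_fiber s

variable {M} in
theorem IsFirst.unique {s : S} {c : M.events s → ℝ} {i j : M.events s} (hi : M.IsFirst s c i)
    (hj : M.IsFirst s c j) : j = i := by
  by_contra h
  exact lt_asymm (hi j h) (hj i (Ne.symm h))

instance : IsMarkovKernel M.step := by
  classical
  refine ⟨fun x => ⟨?_⟩⟩
  change M.stepLaw x.1 x.2 univ = 1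
  unfold stepLaw
  split_ifs with h
  · obtain ⟨-, i, hi⟩ := h
    have hi' : M.IsFirst x.1 x.2 i := hi
    rw [Measure.finsetSum_apply, Finset.sum_eq_single i]
    · rw [if_pos hi', Measure.finsetSum_apply]
      have : ∀ s' : S, (ENNReal.ofReal (M.next x.1 i s') •
          (M.freshLaw x.1 i s').map
            fun y => (⟨s', M.reset x.1 x.2 i s' y⟩ : M.ClockState)) univ =
          ENNReal.ofReal (M.next x.1 i s') := by
        intro s'
        rw [Measure.smul_apply, smul_eq_mul, Measure.map_apply _ MeasurableSet.univ]
        · simp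
        · exact (M.measurable_sigmaMk s').comp
            ((M.measurable_reset x.1 i s').comp measurable_prodMk_left)
      simp only [this]
      rw [← ENNReal.ofReal_sum_of_nonneg (fun s' _ => M.next_nonneg _ _ _), M.next_sum,
        ENNReal.ofReal_one]
    · intro j _ hj
      rw [if_neg fun hj' => hj (hi'.unique hj')]
      rfl
    · simp
  · simp

/-- The law after `n` steps. -/
noncomputable def stepIter : ℕ → Kernel M.ClockState M.ClockState
  | 0 => Kernel.id
  | n + 1 => stepIter n ∘ₖ M.step

/-- The generalized states: exactly one clock reaches zero first, and almost surely this remains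
so after any number of steps, so that the evolution never meets two clocks that reach zero
first simultaneously. -/
def genStates : Set M.ClockState :=
  {x | ∀ n, M.stepIter n x M.validᶜ = 0}

/-- The type of generalized states. -/
abbrev GenState : Type _ := M.genStates

/-- The law, on sequences, of the Markov process with kernel `step` that starts at `x`. -/
noncomputable def pathLaw (x : M.ClockState) : Measure (ℕ → M.ClockState) :=
  Kernel.traj (X := fun _ => M.ClockState)
    (fun n => M.step.comap (fun h => h ⟨n, Finset.mem_Iic.2 le_rfl⟩) (measurable_pi_apply _))
    0 (fun _ => x)

/-- The time of the `n`-th transition. -/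
noncomputable def jumpTime (ω : ℕ → M.ClockState) (n : ℕ) : ℝ :=
  ∑ j ∈ Finset.range n, M.firingTime (ω j)

/-- The finitely varying sequences of generalized states: the times spent have infinite sum. -/
def finitelyVarying : Set (ℕ → M.ClockState) :=
  {ω | (∀ n, ω n ∈ M.genStates) ∧ Tendsto (M.jumpTime ω) atTop atTop}

theorem measurableSet_genStates : MeasurableSet M.genStates := by
  have : M.genStates = ⋂ n, {x | M.stepIter n x M.validᶜ = 0} := by
    ext x; simp [genStates]
  rw [this]
  exact MeasurableSet.iInter fun n => measurableSet_eq_fun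
    ((M.stepIter n).measurable_coe M.measurableSet_valid.compl) measurable_const

theorem measurableSet_finitelyVarying : MeasurableSet M.finitelyVarying := by
  have hm : ∀ n, Measurable fun ω : ℕ → M.ClockState => M.jumpTime ω n := fun n =>
    Finset.measurable_sum _ fun j _ => M.measurable_firingTime.comp (measurable_pi_apply j)
  have h1 : MeasurableSet {ω : ℕ → M.ClockState | ∀ n, ω n ∈ M.genStates} := by
    rw [ofPred_forall]
    exact MeasurableSet.iInter fun n => measurable_pi_apply n M.measurableSet_genStates
  exact h1.inter (measurableSet_tendsto atTop hm)

/-- The type of finitely varying sequences. -/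
abbrev Trace : Type _ := M.finitelyVarying

/-- `Traces ⟨s, c⟩`, the law of the finitely varying sequences that start at `g`. -/
noncomputable def traces (g : M.GenState) : Measure M.Trace :=
  (M.pathLaw g).comap Subtype.val

variable {M}

theorem mem_valid_of_mem_genStates {x : M.ClockState} (hx : x ∈ M.genStates) : x ∈ M.valid := by
  have h := hx 0
  by_contra hv
  rw [stepIter, Kernel.id_apply, Measure.dirac_apply' _ M.measurableSet_valid.compl] at h
  simp [hv] at h

theorem IsFirst.firingTime_eq {x : M.ClockState} {i : M.events x.1} (hi : M.IsFirst x.1 x.2 i) :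
    M.firingTime x = x.2 i / M.rate x.1 i := by
  have : Nonempty (M.events x.1) := ⟨i⟩
  refine le_antisymm (ciInf_le (Set.finite_range _).bddBelow i) (le_ciInf fun j => ?_)
  by_cases h : j = i
  · rw [h]
  · exact (hi j h).le

theorem evolve_div {x : M.ClockState} (u : ℝ) (i : M.events x.1) :
    (M.evolve x u).2 i / M.rate x.1 i = x.2 i / M.rate x.1 i - u := by
  have := (M.rate_pos x.1 i).ne'
  change (x.2 i - M.rate x.1 i * u) / M.rate x.1 i = _
  field_simp

theorem isFirst_evolve {x : M.ClockState} (u : ℝ) (i : M.events x.1) :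
    M.IsFirst x.1 (M.evolve x u).2 i ↔ M.IsFirst x.1 x.2 i := by
  simp only [IsFirst, evolve_div, sub_lt_sub_iff_right]

theorem evolve_mem_valid {x : M.ClockState} (hx : x ∈ M.valid) {u : ℝ}
    (hu : u < M.firingTime x) : M.evolve x u ∈ M.valid := by
  obtain ⟨h0, i, hi⟩ := hx
  refine ⟨fun j => ?_, i, (isFirst_evolve u i).2 hi⟩
  have h1 : M.firingTime x ≤ x.2 j / M.rate x.1 j :=
    ciInf_le (Set.finite_range (fun i : M.events x.1 => x.2 i / M.rate x.1 i)).bddBelow j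
  rw [le_div_iff₀ (M.rate_pos x.1 j)] at h1
  change 0 ≤ x.2 j - M.rate x.1 j * u
  have h2 : M.rate x.1 j * u ≤ M.rate x.1 j * M.firingTime x :=
    mul_le_mul_of_nonneg_left hu.le (M.rate_pos x.1 j).le
  linarith

theorem firingTime_evolve {x : M.ClockState} (hx : x ∈ M.valid) (u : ℝ) :
    M.firingTime (M.evolve x u) = M.firingTime x - u := by
  obtain ⟨-, i, hi⟩ := hx
  have h := (isFirst_evolve u i).2 hi
  rw [IsFirst.firingTime_eq (x := M.evolve x u) h, IsFirst.firingTime_eq hi]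
  exact evolve_div u i

theorem step_evolve {x : M.ClockState} (hx : x ∈ M.valid) {u : ℝ}
    (hu : u < M.firingTime x) : M.step (M.evolve x u) = M.step x := by
  classical
  have hv := evolve_mem_valid hx hu
  have hr : ∀ (i : M.events x.1) (s' : S) (y : M.events s' → ℝ),
      M.reset x.1 (M.evolve x u).2 i s' y = M.reset x.1 x.2 i s' y := by
    intro i s' y
    funext j
    unfold reset
    split_ifs with h
    · have := firingTime_evolve hx u
      change (x.2 _ - M.rate x.1 _ * u) - M.rate x.1 _ * M.firingTime (M.evolve x u) = _
      rw [this]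
      change _ = _ - _ * M.firingTime x
      ring
    · rfl
  change M.stepLaw x.1 (M.evolve x u).2 = M.stepLaw x.1 x.2
  unfold stepLaw
  rw [if_pos (show (⟨x.1, (M.evolve x u).2⟩ : M.ClockState) ∈ M.valid from hv),
    if_pos (show (⟨x.1, x.2⟩ : M.ClockState) ∈ M.valid from hx)]
  simp only [isFirst_evolve, hr]

theorem evolve_mem_genStates {x : M.ClockState} (hx : x ∈ M.genStates) {u : ℝ}
    (hu : u < M.firingTime x) : M.evolve x u ∈ M.genStates := by
  have hv := mem_valid_of_mem_genStates hx
  intro n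
  cases n with
  | zero =>
    rw [stepIter, Kernel.id_apply, Measure.dirac_apply' _ M.measurableSet_valid.compl]
    simp [evolve_mem_valid hv hu]
  | succ n =>
    have h := hx (n + 1)
    rw [stepIter, Kernel.comp_apply] at h ⊢
    rwa [step_evolve hv hu]

theorem exists_lt_jumpTime (ω : M.Trace) (t : ℝ≥0) : ∃ n, (t : ℝ) < M.jumpTime ω.1 (n + 1) := by
  obtain ⟨n, hn⟩ := ((ω.2.2.comp (tendsto_add_atTop_nat 1)).eventually_gt_atTop (t : ℝ)).exists
  exact ⟨n, hn⟩

open Classical in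
/-- The number of transitions up to time `t`. -/
noncomputable def jumpIndex (ω : M.Trace) (t : ℝ≥0) : ℕ := Nat.find (exists_lt_jumpTime ω t)

theorem lt_firingTime (ω : M.Trace) (t : ℝ≥0) :
    (t : ℝ) - M.jumpTime ω.1 (jumpIndex ω t) < M.firingTime (ω.1 (jumpIndex ω t)) := by
  classical
  have h : (t : ℝ) < M.jumpTime ω.1 (jumpIndex ω t + 1) := Nat.find_spec (exists_lt_jumpTime ω t)
  rw [jumpTime, Finset.sum_range_succ] at h
  change (t : ℝ) < M.jumpTime ω.1 (jumpIndex ω t) + _ at h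
  linarith

theorem jumpTime_jumpIndex_le (ω : M.Trace) (t : ℝ≥0) :
    M.jumpTime ω.1 (jumpIndex ω t) ≤ t := by
  classical
  rcases hn : jumpIndex ω t with _ | n
  · simp [jumpTime]
  · have : n < Nat.find (exists_lt_jumpTime ω t) := by
      change n < jumpIndex ω t
      omega
    exact not_lt.1 (Nat.find_min (exists_lt_jumpTime ω t) this)

/-- The function `[0,∞) → GenState` generated by a finitely varying sequence: at a time `t` with
`jumpTime n ≤ t < jumpTime (n + 1)` its value is the `n`-th generalized state, evolved for the
time `t - jumpTime n`. -/
noncomputable def traceFun (ω : M.Trace) (t : ℝ≥0) : M.GenState :=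
  ⟨M.evolve (ω.1 (jumpIndex ω t)) (t - M.jumpTime ω.1 (jumpIndex ω t)),
    evolve_mem_genStates (ω.2.1 _) (lt_firingTime ω t)⟩

variable (M)

instance (x : M.ClockState) : IsProbabilityMeasure (M.pathLaw x) := by
  unfold pathLaw; infer_instance

theorem traces_univ_le (g : M.GenState) : M.traces g univ ≤ 1 :=
  (Measure.comap_apply_le _ _ MeasurableSet.univ.nullMeasurableSet).trans prob_le_one

/-- The set of atomic propositions true at a generalized state. -/
def propsAt (g : M.GenState) : Set AP := M.props g.1.1

/-- The pseudometrics that put generalized states with different propositions at distance one. -/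
def propMetrics : Set (UnitPseudometric M.GenState) :=
  {m | ∀ g g', M.propsAt g ≠ M.propsAt g' → m g g' = 1}

open Classical in
/-- The largest element of `propMetrics`: distance zero if the same propositions are true,
distance one otherwise. -/
noncomputable def topPropMetric : UnitPseudometric M.GenState where
  toFun g g' := if M.propsAt g = M.propsAt g' then 0 else 1
  nonneg g g' := by split_ifs <;> norm_num
  le_one g g' := by split_ifs <;> norm_num
  self g := by simp
  symm g g' := by simp only [eq_comm]
  triangle x y z := by
    by_cases h2 : M.propsAt x = M.propsAt y
    · rw [h2]
      simp
    · rw [if_neg h2]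
      split_ifs <;> norm_num

theorem isGreatest_topPropMetric : IsGreatest M.propMetrics M.topPropMetric := by
  constructor
  · intro g g' h
    exact if_neg h
  · intro m hm g g'
    change (if M.propsAt g = M.propsAt g' then (0 : ℝ) else 1) ≤ m g g'
    split_ifs with h
    · exact m.nonneg _ _
    · exact (hm g g' h).ge

/-- The Skorohod J2 distance of the functions generated by finitely varying sequences. -/
noncomputable def traceMetric (m : UnitPseudometric M.GenState) : UnitPseudometric M.Trace where
  toFun ω ω' := skorohodJ2 m (traceFun ω) (traceFun ω')
  nonneg _ _ := (skorohodJ2 m).nonneg _ _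
  le_one _ _ := (skorohodJ2 m).le_one _ _
  self _ := (skorohodJ2 m).self _
  symm _ _ := (skorohodJ2 m).symm _ _
  triangle _ _ _ := (skorohodJ2 m).triangle _ _ _

open Classical in
/-- The functional `F_k`: generalized states with different propositions get distance one, and
otherwise the distance is `k` times the Wasserstein distance, over the J2 distance of `m`, of the
laws of the traces. -/
noncomputable def bisimFunctional (k : ℝ) (hk0 : 0 < k) (hk1 : k < 1)
    (m : UnitPseudometric M.GenState) : UnitPseudometric M.GenState where
  toFun g g' :=
    if M.propsAt g = M.propsAt g' then
      k * wasserstein (M.traceMetric m) (M.traces g) (M.traces g')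
    else 1
  nonneg g g' := by
    split_ifs
    · exact mul_nonneg hk0.le wasserstein_nonneg
    · exact zero_le_one
  le_one g g' := by
    split_ifs
    · exact mul_le_one₀ hk1.le wasserstein_nonneg
        (wasserstein_le_one (M.traces_univ_le g) (M.traces_univ_le g'))
    · exact le_rfl
  self g := by simp [wasserstein_self]
  symm g g' := by
    rw [wasserstein_comm]
    simp only [eq_comm]
  triangle x y z := by
    have hw : ∀ a b, 0 ≤ k * wasserstein (M.traceMetric m) (M.traces a) (M.traces b) :=
      fun a b => mul_nonneg hk0.le wasserstein_nonneg
    have hw1 : ∀ a b, k * wasserstein (M.traceMetric m) (M.traces a) (M.traces b) ≤ 1 :=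
      fun a b => mul_le_one₀ hk1.le wasserstein_nonneg
        (wasserstein_le_one (M.traces_univ_le a) (M.traces_univ_le b))
    have ht := mul_le_mul_of_nonneg_left (wasserstein_triangle (d := M.traceMetric m)
      (M.traces_univ_le x) (M.traces_univ_le y) (M.traces_univ_le z)) hk0.le
    rw [mul_add] at ht
    split_ifs with h1 h2 h3 h3 h2 h3 h3
    · exact ht
    · exact absurd (h2.symm.trans h1) h3
    · exact absurd (h1.trans h3.symm) h2
    · linarith [hw1 x z]
    · exact absurd (h2.trans h3) h1
    · linarith [hw x y]
    · linarith [hw y z]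
    · norm_num

/-- Whatever `m` is, `F_k m` lies in the class `propMetrics`. -/
theorem bisimFunctional_mem (k : ℝ) (hk0 : 0 < k) (hk1 : k < 1)
    (m : UnitPseudometric M.GenState) : M.bisimFunctional k hk0 hk1 m ∈ M.propMetrics :=
  fun _ _ h => if_neg h

end GSMP

/-! ### Lipschitz dependence of the Skorohod and Wasserstein distances on the pseudometric -/

/-! The functional is a contraction with factor `k` for the uniform distance between pseudometrics,
so the theorem is a form of Banach's fixed point theorem; nothing about the dynamics of the GSMP
enters beyond the fact that `traces g` has mass at most one. If `m ≤ m' + ε` pointwise, the same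
error `ε` passes to the Skorohod distance (`skorohodJ2_le_add`) and from there to the Wasserstein
distance (`wasserstein_le_add`), and the discount multiplies it by `k`.

The Wasserstein step carries the weight. A test function for the larger pseudometric need not be one
for the smaller, but its inf-convolution with the smaller one is, and lies between `h - ε` and `h`
(`IsTest.exists_close`). This is a uniform estimate, so it survives upper integrals, and
measurability of test functions never matters.

Since all distances lie in `[0,1]`, iterates of any two pseudometrics differ by at most `k ^ n`.
Hence the fixed point is unique and attracts every starting point. The starting point matters only
for monotonicity of the chain. -/

theorem graphExcess_le_add {X : Type*} {m m' : UnitPseudometric X} {ε : ℝ} (hε : 0 ≤ ε)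
    (h : ∀ x y, m x y ≤ m' x y + ε) (f g : ℝ≥0 → X) :
    graphExcess m f g ≤ graphExcess m' f g + ε := by
  refine ciSup_le fun t => ?_
  have key : (⨅ t' : ℝ≥0, max (m (f t) (g t')) |(t : ℝ) - t'|) - ε ≤
      ⨅ t' : ℝ≥0, max (m' (f t) (g t')) |(t : ℝ) - t'| := by
    refine le_ciInf fun t' => ?_
    have h1 := ciInf_le (graphExcess_bddBelow m f g t) t'
    -- The time component does not depend on the pseudometric; it is here that `0 ≤ ε` is needed.
    have h2 : max (m (f t) (g t')) |(t : ℝ) - t'| ≤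
        max (m' (f t) (g t')) |(t : ℝ) - t'| + ε :=
      max_le ((h _ _).trans (by gcongr; exact le_max_left _ _))
        ((le_max_right _ _).trans (le_add_of_nonneg_right hε))
    linarith
  exact (sub_le_iff_le_add.1 key).trans
    (by gcongr; exact le_ciSup (graphExcess_bddAbove m' f g) t)

/-- By symmetry of `m` the second half is again an excess, so the one-sided estimate serves both
halves. -/
theorem skorohodJ2_apply {X : Type*} (m : UnitPseudometric X) (f g : ℝ≥0 → X) :
    skorohodJ2 m f g = max (graphExcess m f g) (graphExcess m g f) := by
  change max _ _ = _
  simp only [graphExcess, m.symm, abs_sub_comm]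

theorem skorohodJ2_le_add {X : Type*} {m m' : UnitPseudometric X} {ε : ℝ} (hε : 0 ≤ ε)
    (h : ∀ x y, m x y ≤ m' x y + ε) (f g : ℝ≥0 → X) :
    skorohodJ2 m f g ≤ skorohodJ2 m' f g + ε := by
  rw [skorohodJ2_apply, skorohodJ2_apply, ← max_add_add_right]
  exact max_le_max (graphExcess_le_add hε h f g) (graphExcess_le_add hε h g f)

/-! ### Upper integrals and the Wasserstein distance -/

theorem upperIntegral_le_add {Ω : Type*} [MeasurableSpace Ω] {P : Measure Ω} (hP : P univ ≤ 1)
    {h h' : Ω → ℝ} {ε : ℝ} (hε : 0 ≤ ε) (hh' : ∀ ω, h' ω ≤ 1) (hle : ∀ ω, h ω ≤ h' ω + ε) :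
    upperIntegral P h ≤ upperIntegral P h' + ε := by
  -- The constant majorant 1 keeps the infimum finite; otherwise `toReal` would turn `∞` into `0`
  -- and break the inequality.
  have hfin : (⨅ (φ : Ω → ℝ≥0∞) (_ : Measurable φ) (_ : ∀ ω, ENNReal.ofReal (h' ω) ≤ φ ω),
      ∫⁻ ω, φ ω ∂P) ≠ ∞ := by
    refine ne_top_of_le_ne_top ENNReal.one_ne_top (iInf_le_of_le (fun _ => 1)
      (iInf_le_of_le measurable_const (iInf_le_of_le (fun ω => ?_) ?_)))
    · exact ENNReal.ofReal_le_one.2 (hh' ω)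
    · simpa using hP
  unfold upperIntegral
  rw [← ENNReal.toReal_ofReal hε, ← ENNReal.toReal_add hfin ENNReal.ofReal_ne_top]
  refine ENNReal.toReal_mono (ENNReal.add_ne_top.2 ⟨hfin, ENNReal.ofReal_ne_top⟩) ?_
  simp only [ENNReal.iInf_add]
  refine le_iInf fun φ => le_iInf fun hφ => le_iInf fun hle' => ?_
  -- Raising a measurable majorant of `h'` by `ε` gives one of `h`, at a cost of `ε * P univ ≤ ε`.
  refine iInf_le_of_le (fun ω => φ ω + ENNReal.ofReal ε) (iInf_le_of_le (hφ.add_const _)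
    (iInf_le_of_le (fun ω => ?_) ?_))
  · exact (ENNReal.ofReal_le_ofReal (hle ω)).trans
      (ENNReal.ofReal_add_le.trans (add_le_add_left (hle' ω) _))
  · rw [lintegral_add_left hφ, lintegral_const]
    gcongr
    exact mul_le_of_le_one_right' hP

/-- A test function for `d` is uniformly close to its largest minorant that is Lipschitz for `d'`,
if `d` exceeds `d'` by at most `ε`. -/
theorem IsTest.exists_close {Ω : Type*} {d d' : UnitPseudometric Ω} {ε : ℝ}
    (hd : ∀ x y, d x y ≤ d' x y + ε) {h : Ω → ℝ} (hh : IsTest d h) :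
    ∃ h' : Ω → ℝ, IsTest d' h' ∧ ∀ x, h' x ≤ h x ∧ h x ≤ h' x + ε := by
  have hb : ∀ x, BddBelow (range fun y => h y + d' x y) := fun x =>
    ⟨0, by rintro _ ⟨y, rfl⟩; exact add_nonneg (hh.1 y).1 (d'.nonneg x y)⟩
  have hle : ∀ x, ⨅ y, (h y + d' x y) ≤ h x := fun x =>
    (ciInf_le (hb x) x).trans (by simp [d'.self])
  -- An infimum of functions that are 1-Lipschitz for `d'` is 1-Lipschitz for `d'`.
  have hlip : ∀ x z, ⨅ y, (h y + d' x y) ≤ (⨅ y, (h y + d' z y)) + d' x z := by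
    intro x z
    have : Nonempty Ω := ⟨x⟩
    rw [← sub_le_iff_le_add]
    refine le_ciInf fun y => ?_
    linarith [ciInf_le (hb x) y, d'.triangle x z y]
  refine ⟨fun x => ⨅ y, (h y + d' x y), ⟨fun x => ⟨?_, (hle x).trans (hh.1 x).2⟩,
    fun x z => ?_⟩, fun x => ⟨hle x, ?_⟩⟩
  · exact Real.iInf_nonneg fun y => add_nonneg (hh.1 y).1 (d'.nonneg x y)
  · have h1 := hlip x z
    have h2 := hlip z x
    rw [d'.symm z x] at h2
    exact abs_le.2 ⟨by linarith, by linarith⟩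
  -- For every `y`, `h x ≤ h y + d x y ≤ h y + d' x y + ε`; then take the infimum over `y`.
  · have : Nonempty Ω := ⟨x⟩
    rw [← sub_le_iff_le_add]
    refine le_ciInf fun y => ?_
    linarith [(abs_le.1 (hh.2 x y)).2, hd x y]

theorem wasserstein_le_add {Ω : Type*} [MeasurableSpace Ω] {P Q : Measure Ω}
    (hP : P univ ≤ 1) (hQ : Q univ ≤ 1) {d d' : UnitPseudometric Ω} {ε : ℝ} (hε : 0 ≤ ε)
    (hd : ∀ x y, d x y ≤ d' x y + ε) : wasserstein d P Q ≤ wasserstein d' P Q + ε := by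
  refine csSup_le ⟨_, _, isTest_zero, rfl⟩ ?_
  rintro _ ⟨h, hh, rfl⟩
  obtain ⟨h', hh', hc⟩ := hh.exists_close hd
  have hw : |upperIntegral P h' - upperIntegral Q h'| ≤ wasserstein d' P Q :=
    le_csSup (wasserstein_bddAbove hP hQ) ⟨h', hh', rfl⟩
  -- Because `h'` lies below `h`, the errors for `P` and `Q` both lie in `[0, ε]`, and their
  -- difference costs `ε` instead of `2 * ε`. A factor 2 would spoil the contraction for `k ≥ 1/2`.
  have hbd : ∀ {R : Measure Ω}, R univ ≤ 1 →
      upperIntegral R h' ≤ upperIntegral R h ∧ upperIntegral R h ≤ upperIntegral R h' + ε := by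
    intro R hR
    refine ⟨?_, upperIntegral_le_add hR hε (fun ω => (hh'.1 ω).2) fun ω => (hc ω).2⟩
    -- Monotonicity of the upper integral is the case of error zero.
    simpa using upperIntegral_le_add hR le_rfl (fun ω => (hh.1 ω).2)
      fun ω => (hc ω).1.trans (add_zero (h ω)).ge
  obtain ⟨p1, p2⟩ := hbd hP
  obtain ⟨q1, q2⟩ := hbd hQ
  obtain ⟨w1, w2⟩ := abs_le.1 hw
  exact abs_le.2 ⟨by linarith, by linarith⟩

/-! ### Contractions of the space of pseudometrics -/

namespace UnitPseudometric

variable {X : Type*}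

/-- The pointwise supremum of a sequence of pseudometrics. -/
noncomputable def iSupSeq (m : ℕ → UnitPseudometric X) : UnitPseudometric X where
  toFun x y := ⨆ n, m n x y
  nonneg x y := Real.iSup_nonneg fun n => (m n).nonneg x y
  le_one x y := ciSup_le fun n => (m n).le_one x y
  self x := by simp [(m _).self]
  symm x y := by simp only [(m _).symm x y]
  triangle x y z := by
    have hb : ∀ x y, BddAbove (range fun n => m n x y) := fun x y =>
      ⟨1, by rintro _ ⟨n, rfl⟩; exact (m n).le_one x y⟩
    exact ciSup_le fun n => ((m n).triangle x y z).trans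
      (add_le_add (le_ciSup (hb x y) n) (le_ciSup (hb y z) n))

theorem le_iSupSeq (m : ℕ → UnitPseudometric X) (n : ℕ) (x y : X) : m n x y ≤ iSupSeq m x y :=
  le_ciSup (f := fun n => m n x y) ⟨1, by rintro _ ⟨n, rfl⟩; exact (m n).le_one x y⟩ n

/-- `F` is a contraction with factor `k` for the one-sided uniform distance. -/
def IsContraction (k : ℝ) (F : UnitPseudometric X → UnitPseudometric X) : Prop :=
  ∀ ⦃m m' : UnitPseudometric X⦄ ⦃ε : ℝ⦄, 0 ≤ ε → (∀ x y, m x y ≤ m' x y + ε) →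
    ∀ x y, F m x y ≤ F m' x y + k * ε

variable {k : ℝ} {F : UnitPseudometric X → UnitPseudometric X}

/-- The one-sided form of the contraction property contains monotonicity as the case `ε = 0`. -/
theorem IsContraction.monotone (hF : IsContraction k F) : Monotone F := fun m m' h x y => by
  simpa using hF le_rfl (fun a b => (h a b).trans (add_zero (m a b)).ge) x y

/-- Any two pseudometrics are within `1 = k ^ 0` of each other, and each application of `F` gains a
factor `k`. -/
theorem IsContraction.iterate_le (hF : IsContraction k F) (hk : 0 ≤ k)
    (m m' : UnitPseudometric X) (n : ℕ) (x y : X) : F^[n] m x y ≤ F^[n] m' x y + k ^ n := by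
  induction n generalizing x y with
  | zero => simpa using (m.le_one x y).trans (le_add_of_nonneg_left (m'.nonneg x y))
  | succ n ih =>
    rw [Function.iterate_succ_apply', Function.iterate_succ_apply', pow_succ']
    exact hF (pow_nonneg hk n) ih x y

theorem IsContraction.tendsto_iterate (hF : IsContraction k F) (hk0 : 0 ≤ k) (hk1 : k < 1)
    {m : UnitPseudometric X} (hm : F m = m) (m₀ : UnitPseudometric X) (x y : X) :
    Tendsto (fun n : ℕ => F^[n] m₀ x y) atTop (𝓝 (m x y)) := by
  refine tendsto_iff_norm_sub_tendsto_zero.2 (squeeze_zero (fun _ => norm_nonneg _)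
    (fun n => ?_) (tendsto_pow_atTop_nhds_zero_of_lt_one hk0 hk1))
  have h1 := hF.iterate_le hk0 m₀ m n x y
  have h2 := hF.iterate_le hk0 m m₀ n x y
  rw [Function.iterate_fixed hm n] at h1 h2
  exact abs_le.2 ⟨by linarith, by linarith⟩

/-- Distances along the chain from `⊤` increase, so their pointwise supremum takes the place of a
completeness argument. -/
theorem IsContraction.exists_fixedPoint (hF : IsContraction k F) (hk0 : 0 ≤ k) (hk1 : k < 1) :
    ∃ m, F m = m := by
  have hanti : Antitone fun n : ℕ => F^[n] ⊤ := hF.monotone.antitone_iterate_of_map_le le_top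
  refine ⟨iSupSeq fun n => F^[n] ⊤, ext fun x y => le_antisymm ?_ ?_⟩
  -- The supremum is a uniform limit: `F^[n + j] ⊤` and `F^[n] ⊤` are `n`-th iterates of two
  -- starting points, hence within `k ^ n` for every `j`.
  · have hclose : ∀ (n : ℕ) (x y : X), iSupSeq (fun n => F^[n] ⊤) x y ≤ F^[n] ⊤ x y + k ^ n := by
      intro n x y
      refine ciSup_le fun j => (hanti (Nat.le_add_left j n) x y).trans ?_
      change F^[n + j] ⊤ x y ≤ _
      rw [Function.iterate_add_apply]
      exact hF.iterate_le hk0 _ _ n x y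
    have hlim : Tendsto (fun n : ℕ => iSupSeq (fun n => F^[n] ⊤) x y + k * k ^ n) atTop
        (𝓝 (iSupSeq (fun n => F^[n] ⊤) x y + k * 0)) :=
      ((tendsto_pow_atTop_nhds_zero_of_lt_one hk0 hk1).const_mul k).const_add _
    rw [mul_zero, add_zero] at hlim
    refine ge_of_tendsto' hlim fun n => (hF (pow_nonneg hk0 n) (hclose n) x y).trans ?_
    rw [← Function.iterate_succ_apply' F n ⊤]
    gcongr
    exact le_iSupSeq (fun n => F^[n] ⊤) (n + 1) x y
  -- Passing to index `n + 1` exposes an outer `F`, to which monotonicity applies.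
  · refine ciSup_le fun n => (hanti n.le_succ x y).trans ?_
    change F^[n + 1] ⊤ x y ≤ _
    rw [Function.iterate_succ_apply']
    exact hF.monotone (fun a b => le_iSupSeq (fun n => F^[n] ⊤) n a b) x y

theorem isGLB_of_antitone_of_tendsto {u : ℕ → UnitPseudometric X} {m : UnitPseudometric X}
    (hu : Antitone u) (hlim : ∀ x y, Tendsto (fun n => u n x y) atTop (𝓝 (m x y))) :
    IsGLB (range u) m := by
  constructor
  · rintro _ ⟨n, rfl⟩ x y
    exact ge_of_tendsto (hlim x y) ((eventually_ge_atTop n).mono fun j hj => hu hj x y)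
  · intro m' hm' x y
    exact le_of_tendsto' (hlim x y) fun n => hm' ⟨n, rfl⟩ x y

end UnitPseudometric

/-! ### The functional of the GSMP and its closure ordinal -/

theorem GSMP.isContraction_bisimFunctional {AP S E : Type*} [Fintype S] (M : GSMP AP S E)
    (k : ℝ) (hk0 : 0 < k) (hk1 : k < 1) :
    UnitPseudometric.IsContraction k (M.bisimFunctional k hk0 hk1) := by
  classical
  intro m m' ε hε h g g'
  change (if M.propsAt g = M.propsAt g' then
      k * wasserstein (M.traceMetric m) (M.traces g) (M.traces g') else 1) ≤
    (if M.propsAt g = M.propsAt g' then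
      k * wasserstein (M.traceMetric m') (M.traces g) (M.traces g') else 1) + k * ε
  split_ifs
  · rw [← mul_add]
    exact mul_le_mul_of_nonneg_left (wasserstein_le_add (M.traces_univ_le g)
      (M.traces_univ_le g') hε fun ω ω' => skorohodJ2_le_add hε h _ _) hk0.le
  · exact le_add_of_nonneg_right (mul_nonneg hk0.le hε)

/-- The functional `F_k` has closure ordinal `ω`: its greatest fixed point `mF` in the class
`propMetrics` is the limit of the chain of iterates `m_0, F_k m_0, F_k (F_k m_0), ...`, where `m_0`
is the zero pseudometric or the largest element of `propMetrics`. -/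
theorem mainTheorem3 {AP S E : Type*} [Fintype S] (M : GSMP AP S E) (k : ℝ) (hk0 : 0 < k)
    (hk1 : k < 1) :
    ∃ mF : UnitPseudometric M.GenState,
      IsGreatest {m | m ∈ M.propMetrics ∧ M.bisimFunctional k hk0 hk1 m = m} mF ∧
      ∀ m₀ : UnitPseudometric M.GenState, (m₀ = ⊤ ∨ m₀ = M.topPropMetric) →
        Antitone (fun n : ℕ => (M.bisimFunctional k hk0 hk1)^[n] m₀) ∧
        IsGLB (range fun n : ℕ => (M.bisimFunctional k hk0 hk1)^[n] m₀) mF ∧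
        ∀ g g' : M.GenState,
          Tendsto (fun n : ℕ => ((M.bisimFunctional k hk0 hk1)^[n] m₀) g g') atTop
            (𝓝 (mF g g')) := by
  have hF := M.isContraction_bisimFunctional k hk0 hk1
  obtain ⟨mF, hfix⟩ := hF.exists_fixedPoint hk0.le hk1
  have hlim := hF.tendsto_iterate hk0.le hk1 hfix
  -- Membership in `propMetrics` is automatic for a fixed point, since every value of the functional
  -- lies there.
  refine ⟨mF, ⟨⟨hfix ▸ M.bisimFunctional_mem k hk0 hk1 mF, hfix⟩, ?_⟩, fun m₀ hm₀ => ?_⟩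
  · rintro m ⟨-, hm⟩
    -- Any fixed point `m` equals `mF`: the iterates starting at `m` converge to both.
    refine le_of_eq (UnitPseudometric.ext fun x y => tendsto_nhds_unique ?_ (hlim m x y))
    exact hF.tendsto_iterate hk0.le hk1 hm m x y
  -- The two admissible choices of `m₀` serve only to make the first step descend; the limit is the
  -- same from any start.
  · have hle : M.bisimFunctional k hk0 hk1 m₀ ≤ m₀ := by
      rcases hm₀ with rfl | rfl
      · exact le_top
      · exact M.isGreatest_topPropMetric.2 (M.bisimFunctional_mem k hk0 hk1 _)
    have hanti := hF.monotone.antitone_iterate_of_map_le hle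
    exact ⟨hanti, UnitPseudometric.isGLB_of_antitone_of_tendsto hanti (hlim m₀), hlim m₀⟩
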